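/- Let $\mathcal H$ be a complex Hilbert space, $\hbar>0$, and let $\hat H$ be a (possibly unbounded) self-adjoint operator on $\mathcal H$, the time-independent Hamiltonian of a closed quantum system. Let $\hat U(t)=e^{-\frac{i}{\hbar}t\hat H}$, $t\in\mathbb R$, be its time evolution, i.e. the family of bounded operators with $\hat U(0)=1$ such that for every $\psi_0$ in the domain of $\hat H$ the curve $\psi(t)=\hat U(t)\psi_0$ stays in that domain and solves the Schrödinger equation $i\hbar\,\frac{d}{dt}\psi(t)=\hat H\psi(t)$ on $\mathbb R$. Let $|s_1\rangle,|s_2\rangle\in\mathcal H$ be unit vectors and $t_1<t_2$ real numbers such that: (1) the system can evolve from $|s_1\rangle$ at time $t_1$ to $|s_2\rangle$ at time $t_2$, possibly suffering a projection: $\langle s_2|\hat U(t_2-t_1)|s_1\rangle\neq 0$; (2) $|s_1\rangle$ and $|s_2\rangle$ are perfectly distinguishable: $\langle s_1|s_2\rangle=0$; (3) the probability that the system, being in the state $|s_2\rangle$ at time $t_2$, returns to $|s_1\rangle$ at a later time is zero: $|\langle s_1|\hat U(t-t_2)|s_2\rangle|^2=0$ for all $t>t_2$. Then the system cannot have a ground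 state: $\hat H$ is not bounded below, i.e. there is no $E\in\mathbb R$ with $\langle\psi|\hat H|\psi\rangle\ge E\,\langle\psi|\psi\rangle$ for all $\psi$ in the domain of $\hat H$; in particular, $\hat H$ has no eigenvector whose eigenvalue is such a lower bound $E$. -/

import Mathlib

open scoped InnerProductSpace

/-- `U` is the propagator of the Schrödinger equation `iħ dψ/dt = Hψ`: a family of bounded operators
with `U 0 = 1` such that, for every initial vector `ψ₀` in the domain of `H`, the curve
`t ↦ U t ψ₀` stays in the domain of `H` and has the derivative `-(i/ħ) H (U t ψ₀)` at every time.
When `H` is self-adjoint, there is exactly one such family, the strongly continuous one-parameter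
unitary group `exp (-(i/ħ) t H)`. -/
structure IsPropagator {𝓗 : Type*} [NormedAddCommGroup 𝓗] [InnerProductSpace ℂ 𝓗]
    (ħ : ℝ) (H : 𝓗 →ₗ.[ℂ] 𝓗) (U : ℝ → 𝓗 →L[ℂ] 𝓗) : Prop where
  map_zero : U 0 = 1
  schrodinger : ∀ ψ₀ ∈ H.domain, ∀ t : ℝ, ∃ h : U t ψ₀ ∈ H.domain,
    HasDerivAt (fun s : ℝ => U s ψ₀) (-(Complex.I / (ħ : ℂ)) • H ⟨U t ψ₀, h⟩) t

/-- The propagator of a self-adjoint Hamiltonian is unique. -/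
theorem IsPropagator.unique {𝓗 : Type*} [NormedAddCommGroup 𝓗] [InnerProductSpace ℂ 𝓗]
    [CompleteSpace 𝓗] {ħ : ℝ} {H : 𝓗 →ₗ.[ℂ] 𝓗} (hH : IsSelfAdjoint H)
    {U V : ℝ → 𝓗 →L[ℂ] 𝓗} (hU : IsPropagator ħ H U) (hV : IsPropagator ħ H V) : U = V := by
  have hdense : Dense (H.domain : Set 𝓗) := hH.dense_domain
  have hsymm : ∀ x y : H.domain, ⟪H x, (y : 𝓗)⟫_ℂ = ⟪(x : 𝓗), H y⟫_ℂ := by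
    have h := LinearPMap.adjoint_isFormalAdjoint hdense
    rw [LinearPMap.isSelfAdjoint_def.mp hH] at h
    exact h
  funext t
  refine ContinuousLinearMap.ext fun ψ => ?_
  refine congrFun (Continuous.ext_on hdense (U t).continuous (V t).continuous ?_) ψ
  intro ψ₀ hψ₀
  have key : ∀ s : ℝ, HasDerivAt
      (fun s : ℝ => ⟪U s ψ₀ - V s ψ₀, U s ψ₀ - V s ψ₀⟫_ℂ) 0 s := by
    intro s
    obtain ⟨hu, du⟩ := hU.schrodinger ψ₀ hψ₀ s
    obtain ⟨hv, dv⟩ := hV.schrodinger ψ₀ hψ₀ s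
    have hd := du.sub dv
    rw [← smul_sub, ← LinearPMap.map_sub] at hd
    have h2 := hd.inner ℂ hd
    have hs := hsymm (⟨U s ψ₀, hu⟩ - ⟨V s ψ₀, hv⟩) (⟨U s ψ₀, hu⟩ - ⟨V s ψ₀, hv⟩)
    simp only [Submodule.coe_sub] at hs
    refine h2.congr_deriv ?_
    simp only [Pi.sub_apply, inner_smul_left, inner_smul_right, hs]
    simp [inner_sub_left]
    ring
  have hconst := is_const_of_deriv_eq_zero (fun s => (key s).differentiableAt)
    (fun s => (key s).deriv) t 0
  simp only [hU.map_zero, hV.map_zero, sub_self, inner_zero_left] at hconst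
  exact sub_eq_zero.mp (inner_self_eq_zero.mp hconst)

open Classical in
/-- The time evolution operator `U(t) = exp (-(i/ħ) t H)` of a self-adjoint Hamiltonian `H`,
defined as the propagator of the Schrödinger equation with Hamiltonian `H`. -/
noncomputable def timeEvolution {𝓗 : Type*} [NormedAddCommGroup 𝓗] [InnerProductSpace ℂ 𝓗]
    (ħ : ℝ) (H : 𝓗 →ₗ.[ℂ] 𝓗) : ℝ → 𝓗 →L[ℂ] 𝓗 :=
  if h : ∃ U : ℝ → 𝓗 →L[ℂ] 𝓗, IsPropagator ħ H U then h.choose else 0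

/-- For a self-adjoint Hamiltonian, `timeEvolution ħ H` is the propagator. -/
theorem IsPropagator.timeEvolution_eq {𝓗 : Type*} [NormedAddCommGroup 𝓗] [InnerProductSpace ℂ 𝓗]
    [CompleteSpace 𝓗] {ħ : ℝ} {H : 𝓗 →ₗ.[ℂ] 𝓗} (hH : IsSelfAdjoint H)
    {U : ℝ → 𝓗 →L[ℂ] 𝓗} (hU : IsPropagator ħ H U) : timeEvolution ħ H = U := by
  have h : ∃ U : ℝ → 𝓗 →L[ℂ] 𝓗, IsPropagator ħ H U := ⟨U, hU⟩
  rw [timeEvolution, dif_pos h]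
  exact IsPropagator.unique hH h.choose_spec hU

/-- `E` is a lower bound of the energy: `⟨ψ|H|ψ⟩ ≥ E ⟨ψ|ψ⟩` for all `ψ` in the domain of `H`. -/
def IsEnergyLowerBound {𝓗 : Type*} [NormedAddCommGroup 𝓗] [InnerProductSpace ℂ 𝓗]
    (H : 𝓗 →ₗ.[ℂ] 𝓗) (E : ℝ) : Prop :=
  ∀ ψ : H.domain, E * ‖(ψ : 𝓗)‖ ^ 2 ≤ (⟪(ψ : 𝓗), H ψ⟫_ℂ).re

/-- The Hamiltonian is bounded below. -/
def IsBoundedBelow {𝓗 : Type*} [NormedAddCommGroup 𝓗] [InnerProductSpace ℂ 𝓗]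
    (H : 𝓗 →ₗ.[ℂ] 𝓗) : Prop :=
  ∃ E : ℝ, IsEnergyLowerBound H E

/-- The Hamiltonian has a ground state vector: an eigenvector whose energy is the minimum. -/
def HasGroundState {𝓗 : Type*} [NormedAddCommGroup 𝓗] [InnerProductSpace ℂ 𝓗]
    (H : 𝓗 →ₗ.[ℂ] 𝓗) : Prop :=
  ∃ (E : ℝ) (Ω : H.domain), (Ω : 𝓗) ≠ 0 ∧ H Ω = (E : ℂ) • (Ω : 𝓗) ∧ IsEnergyLowerBound H E

/-!
Let `μ` be a real number outside the spectrum of `H`. The states that have zero amplitude to reach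
`s₁` at every time `t ≥ 0` form a closed subspace `M` with `U t M ⊆ M` for `t ≥ 0`. It is also
invariant under `(H - μ)⁻¹`, because a bounded function with constant derivative on `[0, ∞)` has
derivative zero. Hence the orthogonal projection onto `M` commutes with `H`, so with every `U t`,
and `U t M ⊆ M` for negative `t` as well. Thus an amplitude to reach `s₁` that vanishes at all large
times vanishes at all times. The return amplitude from `s₂` to `s₁` vanishes for `t > 0` but not at
`t₁ - t₂`, so there is no such `μ`: every real number is in the spectrum, whereas a lower bound on
the energy would leave a half-line out of it.
-/

section OperatorSpectrum

variable {𝕜 𝓗 : Type*} [RCLike 𝕜] [NormedAddCommGroup 𝓗] [InnerProductSpace 𝕜 𝓗]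

/-- The operator `H - z`, as a linear map on the domain of `H`. -/
def subScalar (H : 𝓗 →ₗ.[𝕜] 𝓗) (z : 𝕜) : H.domain →ₗ[𝕜] 𝓗 :=
  H.toFun - z • H.domain.subtype

/-- The spectrum of an unbounded operator `H`. No boundedness is asked of `(H - z)⁻¹`: for a closed
operator it is automatic. -/
def operatorSpectrum (H : 𝓗 →ₗ.[𝕜] 𝓗) : Set 𝕜 :=
  {z | ¬ Function.Bijective (subScalar H z)}

theorem subScalar_apply (H : 𝓗 →ₗ.[𝕜] 𝓗) (z : 𝕜) (x : H.domain) :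
    subScalar H z x = H x - z • (x : 𝓗) := rfl

theorem inner_subScalar_left {H : 𝓗 →ₗ.[𝕜] 𝓗} (hH : H.IsFormalAdjoint H) (μ : ℝ)
    (x y : H.domain) :
    ⟪subScalar H (μ : 𝕜) x, (y : 𝓗)⟫_𝕜 = ⟪(x : 𝓗), subScalar H (μ : 𝕜) y⟫_𝕜 := by
  rw [subScalar_apply, subScalar_apply, inner_sub_left, inner_sub_right, inner_smul_left,
    inner_smul_right, RCLike.conj_ofReal, hH x y]

theorem isClosed_range_subScalar [CompleteSpace 𝓗] {H : 𝓗 →ₗ.[𝕜] 𝓗} (hH : H.IsClosed) {z : 𝕜}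
    {K : NNReal} (hK : AntilipschitzWith K (subScalar H z)) :
    IsClosed (LinearMap.range (subScalar H z) : Set 𝓗) := by
  refine IsSeqClosed.isClosed fun u y hu huy => ?_
  choose x hx using hu
  have hu_cauchy : Filter.Tendsto (Prod.map (subScalar H z) (subScalar H z) ∘ Prod.map x x)
      Filter.atTop (uniformity 𝓗) := by
    rw [Prod.map_comp_map, show subScalar H z ∘ x = u from funext hx]
    exact huy.cauchySeq.tendsto_uniformity
  have hx_cauchy : CauchySeq x := cauchySeq_iff_tendsto.2
    ((Filter.tendsto_comap_iff.2 hu_cauchy).mono_right hK.comap_uniformity_le)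
  obtain ⟨a, ha⟩ := cauchySeq_tendsto_of_complete
    (uniformContinuous_subtype_val.comp_cauchySeq hx_cauchy)
  have hHx : ∀ n, H (x n) = u n + z • (x n : 𝓗) := fun n => by
    rw [← hx, subScalar_apply, sub_add_cancel]
  have hgraph : (a, y + z • a) ∈ H.graph :=
    hH.isSeqClosed (x := fun n => ((x n : 𝓗), H (x n))) (fun n => H.mem_graph (x n)) (by
      simp only [hHx]
      exact ha.prodMk_nhds (huy.add (ha.const_smul z)))
  obtain ⟨v, rfl, hv⟩ := (LinearPMap.mem_graph_iff H).1 hgraph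
  exact ⟨v, by rw [subScalar_apply, hv, add_sub_cancel_right]⟩

theorem starProjection_mem_domain_and_map {H : 𝓗 →ₗ.[𝕜] 𝓗} (hH : H.IsFormalAdjoint H) {μ : ℝ}
    (hsurj : Function.Surjective (subScalar H (μ : 𝕜))) (M : Submodule 𝕜 𝓗)
    [M.HasOrthogonalProjection]
    (hM : ∀ v : H.domain, subScalar H (μ : 𝕜) v ∈ M → (v : 𝓗) ∈ M) (v : H.domain) :
    ∃ h : M.starProjection v ∈ H.domain, H ⟨M.starProjection v, h⟩ = M.starProjection (H v) := by
  have hMorth : ∀ w : H.domain, subScalar H (μ : 𝕜) w ∈ Mᗮ → (w : 𝓗) ∈ Mᗮ := by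
    refine fun w hw m hm => ?_
    obtain ⟨m', rfl⟩ := hsurj m
    rw [inner_subScalar_left hH]
    exact hw m' (hM m' hm)
  obtain ⟨p, hp⟩ := hsurj (M.starProjection (subScalar H (μ : 𝕜) v))
  have hp_mem : (p : 𝓗) ∈ M := hM p (hp ▸ M.starProjection_apply_mem _)
  have hp_orth : (v : 𝓗) - p ∈ Mᗮ := hMorth (v - p) (by
    rw [map_sub, hp]
    exact M.sub_starProjection_mem_orthogonal _)
  have hpv : M.starProjection (v : 𝓗) = p :=
    Submodule.eq_starProjection_of_mem_orthogonal hp_mem hp_orth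
  refine ⟨hpv ▸ p.2, ?_⟩
  simp only [hpv]
  simpa only [subScalar_apply, map_sub, map_smul, hpv, sub_left_inj] using hp

variable [CompleteSpace 𝓗] {H : 𝓗 →ₗ.[𝕜] 𝓗}

theorem isFormalAdjoint_self_of_isSelfAdjoint (hH : IsSelfAdjoint H) : H.IsFormalAdjoint H := by
  simpa only [LinearPMap.isSelfAdjoint_def.1 hH] using
    LinearPMap.adjoint_isFormalAdjoint hH.dense_domain

theorem mem_graph_of_forall_inner_eq (hH : IsSelfAdjoint H) {y w : 𝓗}
    (h : ∀ x : H.domain, ⟪(x : 𝓗), w⟫_𝕜 = ⟪H x, y⟫_𝕜) : (y, w) ∈ H.graph := by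
  rw [← LinearPMap.isSelfAdjoint_def.1 hH,
    LinearPMap.adjoint_graph_eq_graph_adjoint hH.dense_domain, Submodule.mem_adjoint_iff]
  intro a b hab
  obtain ⟨x, rfl, rfl⟩ := (LinearPMap.mem_graph_iff H).1 hab
  exact sub_eq_zero.2 (h x).symm

theorem notMem_operatorSpectrum_of_antilipschitzWith (hH : IsSelfAdjoint H) {μ : ℝ} {K : NNReal}
    (hK : AntilipschitzWith K (subScalar H (μ : 𝕜))) : (μ : 𝕜) ∉ operatorSpectrum H := by
  refine not_not.2 ⟨hK.injective, ?_⟩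
  rw [← LinearMap.range_eq_top,
    ← (isClosed_range_subScalar hH.isClosed hK).submodule_topologicalClosure_eq,
    Submodule.topologicalClosure_eq_top_iff, Submodule.eq_bot_iff]
  intro y hy
  have hgraph : (y, (μ : 𝕜) • y) ∈ H.graph := mem_graph_of_forall_inner_eq hH fun x => by
    have h := hy _ ⟨x, rfl⟩
    rw [subScalar_apply, inner_sub_left, inner_smul_left, RCLike.conj_ofReal, sub_eq_zero] at h
    rw [inner_smul_right, h]
  obtain ⟨v, rfl, hv⟩ := (LinearPMap.mem_graph_iff H).1 hgraph
  have hv0 : v = 0 := hK.injective (by rw [subScalar_apply, hv, sub_self, map_zero])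
  rw [hv0, Submodule.coe_zero]

end OperatorSpectrum

section EnergyLowerBound

variable {𝓗 : Type*} [NormedAddCommGroup 𝓗] [InnerProductSpace ℂ 𝓗] {H : 𝓗 →ₗ.[ℂ] 𝓗} {E : ℝ}

theorem IsEnergyLowerBound.sub_mul_norm_le (hE : IsEnergyLowerBound H E) (μ : ℝ) (v : H.domain) :
    (E - μ) * ‖(v : 𝓗)‖ ≤ ‖subScalar H (μ : ℂ) v‖ := by
  rcases (norm_nonneg (v : 𝓗)).eq_or_lt' with hv | hv
  · rw [hv, mul_zero]
    exact norm_nonneg _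
  refine le_of_mul_le_mul_left ?_ hv
  have hre : (⟪(v : 𝓗), subScalar H (μ : ℂ) v⟫_ℂ).re =
      (⟪(v : 𝓗), H v⟫_ℂ).re - μ * ‖(v : 𝓗)‖ ^ 2 := by
    rw [subScalar_apply, inner_sub_right, inner_smul_right, Complex.sub_re, Complex.re_ofReal_mul,
      ← inner_self_eq_norm_sq (𝕜 := ℂ), RCLike.re_to_complex]
  calc ‖(v : 𝓗)‖ * ((E - μ) * ‖(v : 𝓗)‖) = E * ‖(v : 𝓗)‖ ^ 2 - μ * ‖(v : 𝓗)‖ ^ 2 := by ring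
    _ ≤ (⟪(v : 𝓗), H v⟫_ℂ).re - μ * ‖(v : 𝓗)‖ ^ 2 := sub_le_sub_right (hE v) _
    _ = (⟪(v : 𝓗), subScalar H (μ : ℂ) v⟫_ℂ).re := hre.symm
    _ ≤ ‖(v : 𝓗)‖ * ‖subScalar H (μ : ℂ) v‖ := re_inner_le_norm (𝕜 := ℂ) _ _

theorem IsEnergyLowerBound.notMem_operatorSpectrum [CompleteSpace 𝓗] (hE : IsEnergyLowerBound H E)
    (hH : IsSelfAdjoint H) {μ : ℝ} (hμ : μ < E) : (μ : ℂ) ∉ operatorSpectrum H := by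
  have hpos : 0 < E - μ := sub_pos.2 hμ
  refine notMem_operatorSpectrum_of_antilipschitzWith hH (K := (E - μ).toNNReal⁻¹)
    (AddMonoidHomClass.antilipschitz_of_bound _ fun v => ?_)
  rw [NNReal.coe_inv, Real.coe_toNNReal _ hpos.le, inv_mul_eq_div, le_div_iff₀' hpos]
  exact hE.sub_mul_norm_le μ v

theorem HasGroundState.isBoundedBelow (h : HasGroundState H) : IsBoundedBelow H :=
  let ⟨E, _, _, _, hE⟩ := h
  ⟨E, hE⟩

end EnergyLowerBound

section BoundedAffine

variable {F : Type*} [NormedAddCommGroup F] [NormedSpace ℝ F] {f : ℝ → F} {c : F}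

theorem eq_add_smul_of_hasDerivAt_const (hf : ∀ t, 0 ≤ t → HasDerivAt f c t) {t : ℝ}
    (ht : 0 ≤ t) : f t = f 0 + t • c := by
  have hderiv : ∀ s, 0 ≤ s → HasDerivAt (fun s => f s - s • c) 0 s := fun s hs => by
    simpa using! (hf s hs).sub ((hasDerivAt_id s).smul_const c)
  have hconst := constant_of_has_deriv_right_zero
    (fun s hs => (hderiv s hs.1).continuousAt.continuousWithinAt)
    (fun s hs => (hderiv s hs.1).hasDerivWithinAt) t ⟨ht, le_rfl⟩
  rwa [zero_smul, sub_zero, sub_eq_iff_eq_add] at hconst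

theorem eq_zero_of_hasDerivAt_const_of_norm_le (hf : ∀ t, 0 ≤ t → HasDerivAt f c t) {C : ℝ}
    (hC : ∀ t, 0 ≤ t → ‖f t‖ ≤ C) : c = 0 := by
  by_contra hc
  have hgrowth : ∀ t, 0 ≤ t → t * ‖c‖ ≤ C + C := fun t ht => by
    calc t * ‖c‖ = ‖f t - f 0‖ := by
          rw [eq_add_smul_of_hasDerivAt_const hf ht, add_sub_cancel_left, norm_smul,
            Real.norm_of_nonneg ht]
      _ ≤ C + C := norm_sub_le_of_le (hC t ht) (hC 0 le_rfl)
  obtain ⟨t, ht0, ht⟩ := ((Filter.eventually_ge_atTop 0).and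
    ((Filter.tendsto_id.atTop_mul_const (norm_pos_iff.2 hc)).eventually_gt_atTop (C + C))).exists
  exact (hgrowth t ht0).not_gt ht

end BoundedAffine

section Propagator

variable {𝓗 : Type*} [NormedAddCommGroup 𝓗] [InnerProductSpace ℂ 𝓗]
  {ħ : ℝ} {H : 𝓗 →ₗ.[ℂ] 𝓗} {U : ℝ → 𝓗 →L[ℂ] 𝓗} {φ ψ : ℝ → 𝓗}

/-- The curve `ψ` solves the Schrödinger equation `iħ dψ/dt = Hψ`, on all of `ℝ`. -/
def IsSchrodingerSolution (ħ : ℝ) (H : 𝓗 →ₗ.[ℂ] 𝓗) (ψ : ℝ → 𝓗) : Prop :=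
  ∀ t : ℝ, ∃ h : ψ t ∈ H.domain, HasDerivAt ψ (-(Complex.I / (ħ : ℂ)) • H ⟨ψ t, h⟩) t

theorem IsSchrodingerSolution.sub (hφ : IsSchrodingerSolution ħ H φ)
    (hψ : IsSchrodingerSolution ħ H ψ) : IsSchrodingerSolution ħ H (φ - ψ) := fun t => by
  obtain ⟨hφt, dφ⟩ := hφ t
  obtain ⟨hψt, dψ⟩ := hψ t
  refine ⟨H.domain.sub_mem hφt hψt, (dφ.sub dψ).congr_deriv ?_⟩
  rw [← smul_sub, ← LinearPMap.map_sub]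
  rfl

theorem IsSchrodingerSolution.comp_add_const (hψ : IsSchrodingerSolution ħ H ψ) (a : ℝ) :
    IsSchrodingerSolution ħ H (fun t => ψ (t + a)) := fun t =>
  let ⟨h, d⟩ := hψ (t + a)
  ⟨h, d.comp_add_const t a⟩

theorem IsSchrodingerSolution.clm_comp (hψ : IsSchrodingerSolution ħ H ψ) {B : 𝓗 →L[ℂ] 𝓗}
    (hB : ∀ v : H.domain, ∃ h : B v ∈ H.domain, H ⟨B v, h⟩ = B (H v)) :
    IsSchrodingerSolution ħ H (fun t => B (ψ t)) := fun t => by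
  obtain ⟨h, d⟩ := hψ t
  obtain ⟨hBψ, hHB⟩ := hB ⟨ψ t, h⟩
  refine ⟨hBψ, ((B.restrictScalars ℝ).hasFDerivAt.comp_hasDerivAt t d).congr_deriv ?_⟩
  rw [hHB, ContinuousLinearMap.coe_restrictScalars', map_smul]

theorem IsSchrodingerSolution.norm_eq (hH : H.IsFormalAdjoint H)
    (hψ : IsSchrodingerSolution ħ H ψ) (t : ℝ) : ‖ψ t‖ = ‖ψ 0‖ := by
  have hderiv : ∀ s, HasDerivAt (fun s => ⟪ψ s, ψ s⟫_ℂ) 0 s := fun s => by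
    obtain ⟨h, d⟩ := hψ s
    refine (d.inner ℂ d).congr_deriv ?_
    have hsymm : ⟪H ⟨ψ s, h⟩, ψ s⟫_ℂ = ⟪ψ s, H ⟨ψ s, h⟩⟫_ℂ := hH ⟨ψ s, h⟩ ⟨ψ s, h⟩
    rw [inner_smul_left, inner_smul_right, hsymm, map_neg, map_div₀, Complex.conj_I,
      Complex.conj_ofReal]
    ring
  have hconst := is_const_of_deriv_eq_zero (fun s => (hderiv s).differentiableAt)
    (fun s => (hderiv s).deriv) t 0
  rw [@norm_eq_sqrt_re_inner ℂ, hconst, ← @norm_eq_sqrt_re_inner ℂ]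

theorem IsSchrodingerSolution.unique (hH : H.IsFormalAdjoint H)
    (hφ : IsSchrodingerSolution ħ H φ) (hψ : IsSchrodingerSolution ħ H ψ) (h0 : φ 0 = ψ 0) :
    φ = ψ := by
  funext t
  have h := (hφ.sub hψ).norm_eq hH t
  rwa [Pi.sub_apply, Pi.sub_apply, h0, sub_self, norm_zero, norm_sub_eq_zero_iff] at h

namespace IsPropagator

theorem isSchrodingerSolution (hU : IsPropagator ħ H U) (v : H.domain) :
    IsSchrodingerSolution ħ H (fun t => U t v) := hU.schrodinger v v.2

theorem apply_zero (hU : IsPropagator ħ H U) (x : 𝓗) : U 0 x = x := by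
  rw [hU.map_zero, one_apply_eq_self]

theorem apply_mem_domain (hU : IsPropagator ħ H U) (t : ℝ) (v : H.domain) : U t v ∈ H.domain :=
  (hU.isSchrodingerSolution v t).1

theorem norm_apply (hU : IsPropagator ħ H U) (hH : H.IsFormalAdjoint H)
    (hdense : Dense (H.domain : Set 𝓗)) (t : ℝ) (x : 𝓗) : ‖U t x‖ = ‖x‖ := by
  refine congrFun ((U t).continuous.norm.ext_on hdense continuous_norm fun v hv => ?_) x
  simpa only [hU.apply_zero] using (hU.isSchrodingerSolution ⟨v, hv⟩).norm_eq hH t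

theorem apply_comm_of_map_comm (hU : IsPropagator ħ H U) (hH : H.IsFormalAdjoint H)
    (hdense : Dense (H.domain : Set 𝓗)) {B : 𝓗 →L[ℂ] 𝓗}
    (hB : ∀ v : H.domain, ∃ h : B v ∈ H.domain, H ⟨B v, h⟩ = B (H v)) (t : ℝ) (x : 𝓗) :
    U t (B x) = B (U t x) := by
  refine congrFun ((U t ∘L B).continuous.ext_on hdense (B ∘L U t).continuous fun v hv => ?_) x
  obtain ⟨hBv, -⟩ := hB ⟨v, hv⟩
  exact congrFun ((hU.isSchrodingerSolution ⟨B v, hBv⟩).unique hH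
    ((hU.isSchrodingerSolution ⟨v, hv⟩).clm_comp hB) (by simp only [hU.apply_zero])) t

theorem apply_add (hU : IsPropagator ħ H U) (hH : H.IsFormalAdjoint H)
    (hdense : Dense (H.domain : Set 𝓗)) (s t : ℝ) (x : 𝓗) : U (s + t) x = U s (U t x) := by
  refine congrFun ((U (s + t)).continuous.ext_on hdense (U s ∘L U t).continuous fun v hv => ?_) x
  exact congrFun (((hU.isSchrodingerSolution ⟨v, hv⟩).comp_add_const t).unique hH
    (hU.isSchrodingerSolution ⟨U t v, hU.apply_mem_domain t ⟨v, hv⟩⟩)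
    (by simp only [zero_add, hU.apply_zero])) s

theorem inner_apply_left (hU : IsPropagator ħ H U) (hH : H.IsFormalAdjoint H)
    (hdense : Dense (H.domain : Set 𝓗)) (t : ℝ) (x y : 𝓗) : ⟪U t x, y⟫_ℂ = ⟪x, U (-t) y⟫_ℂ := by
  have hy : U t (U (-t) y) = y := by
    rw [← hU.apply_add hH hdense, add_neg_cancel, hU.apply_zero]
  conv_lhs => rw [← hy]
  exact (LinearMap.norm_map_iff_inner_map_map (U t)).1 (hU.norm_apply hH hdense t) x (U (-t) y)

theorem map_apply (hU : IsPropagator ħ H U) (hħ : ħ ≠ 0) (hH : H.IsFormalAdjoint H)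
    (hdense : Dense (H.domain : Set 𝓗)) (t : ℝ) (v : H.domain) :
    H ⟨U t v, hU.apply_mem_domain t v⟩ = U t (H v) := by
  obtain ⟨h₁, d₁⟩ := hU.isSchrodingerSolution ⟨U t v, hU.apply_mem_domain t v⟩ 0
  obtain ⟨h₂, d₂⟩ := hU.isSchrodingerSolution v 0
  have d₂' := ((U t).restrictScalars ℝ).hasFDerivAt.comp_hasDerivAt 0 d₂
  have hcomm : ((U t).restrictScalars ℝ ∘ fun s => U s v) = fun s => U s (U t v) := by
    funext s
    simp only [Function.comp_apply, ContinuousLinearMap.coe_restrictScalars',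
      ← hU.apply_add hH hdense, add_comm]
  rw [hcomm] at d₂'
  have h := d₁.unique d₂'
  simp only [hU.apply_zero, ContinuousLinearMap.coe_restrictScalars', map_smul] at h
  refine smul_right_injective 𝓗 ?_ h
  exact neg_ne_zero.2 (div_ne_zero Complex.I_ne_zero (Complex.ofReal_ne_zero.2 hħ))

end IsPropagator

/-- The transition amplitude from `v` to `u` after time `t` under the Hamiltonian `H - μ`, where `U`
is the propagator of `H`. -/
noncomputable def shiftedAmplitude (ħ : ℝ) (U : ℝ → 𝓗 →L[ℂ] 𝓗) (μ : ℝ) (u v : 𝓗) (t : ℝ) : ℂ :=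
  Complex.exp ((μ / ħ * t : ℝ) * Complex.I) * ⟪u, U t v⟫_ℂ

namespace IsPropagator

theorem norm_shiftedAmplitude_le (hU : IsPropagator ħ H U) (hH : H.IsFormalAdjoint H)
    (hdense : Dense (H.domain : Set 𝓗)) (μ : ℝ) (u v : 𝓗) (t : ℝ) :
    ‖shiftedAmplitude ħ U μ u v t‖ ≤ ‖u‖ * ‖v‖ := by
  rw [shiftedAmplitude, norm_mul, Complex.norm_exp_ofReal_mul_I, one_mul,
    ← hU.norm_apply hH hdense t v]
  exact norm_inner_le_norm u (U t v)

theorem hasDerivAt_shiftedAmplitude (hU : IsPropagator ħ H U) (hħ : ħ ≠ 0)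
    (hH : H.IsFormalAdjoint H) (hdense : Dense (H.domain : Set 𝓗)) (μ : ℝ) (u : 𝓗)
    (v : H.domain) (t : ℝ) :
    HasDerivAt (shiftedAmplitude ħ U μ u v)
      (-(Complex.I / ħ) * shiftedAmplitude ħ U μ u (subScalar H (μ : ℂ) v) t) t := by
  obtain ⟨_, d⟩ := hU.isSchrodingerSolution v t
  rw [hU.map_apply hħ hH hdense] at d
  have dphase : HasDerivAt (fun t : ℝ => Complex.exp ((μ / ħ * t : ℝ) * Complex.I))
      (Complex.exp ((μ / ħ * t : ℝ) * Complex.I) * ((μ / ħ : ℝ) * Complex.I)) t := by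
    simpa using
      (((hasDerivAt_id t).const_mul (μ / ħ)).ofReal_comp.mul_const Complex.I).cexp
  refine (dphase.mul ((hasDerivAt_const t u).inner ℂ d)).congr_deriv ?_
  rw [shiftedAmplitude, subScalar_apply, map_sub, map_smul, inner_sub_right, inner_smul_right,
    inner_smul_right, inner_zero_left]
  push_cast
  ring

/- If `(H - μ) w = v` and `(H - μ) v ∈ M`, then for `u ⊥ M` the shifted amplitude of `v` is constant
for `t ≥ 0` and is, up to a factor, the derivative of the bounded shifted amplitude of `w`. -/
theorem mem_of_subScalar_mem (hU : IsPropagator ħ H U) (hħ : ħ ≠ 0) (hH : H.IsFormalAdjoint H)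
    (hdense : Dense (H.domain : Set 𝓗)) {μ : ℝ}
    (hsurj : Function.Surjective (subScalar H (μ : ℂ))) {M : Submodule ℂ 𝓗}
    [M.HasOrthogonalProjection] (hM : ∀ t, 0 ≤ t → Set.MapsTo (U t) M M) {v : H.domain}
    (hv : subScalar H (μ : ℂ) v ∈ M) : (v : 𝓗) ∈ M := by
  rw [← M.orthogonal_orthogonal]
  intro u hu
  obtain ⟨w, hw⟩ := hsurj v
  have hderiv_v : ∀ t, 0 ≤ t → HasDerivAt (shiftedAmplitude ħ U μ u v) 0 t := fun t ht =>
    (hU.hasDerivAt_shiftedAmplitude hħ hH hdense μ u v t).congr_deriv (by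
      rw [shiftedAmplitude, Submodule.inner_left_of_mem_orthogonal (hM t ht hv) hu, mul_zero,
        mul_zero])
  have hconst : ∀ t, 0 ≤ t → shiftedAmplitude ħ U μ u v t = ⟪u, v⟫_ℂ := fun t ht => by
    rw [eq_add_smul_of_hasDerivAt_const hderiv_v ht]
    simp [shiftedAmplitude, hU.apply_zero]
  have hderiv_w : ∀ t, 0 ≤ t →
      HasDerivAt (shiftedAmplitude ħ U μ u w) (-(Complex.I / ħ) * ⟪u, v⟫_ℂ) t := fun t ht => by
    simpa only [hw, hconst t ht] using hU.hasDerivAt_shiftedAmplitude hħ hH hdense μ u w t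
  have hzero := eq_zero_of_hasDerivAt_const_of_norm_le hderiv_w
    fun t _ => hU.norm_shiftedAmplitude_le hH hdense μ u w t
  exact (mul_eq_zero.1 hzero).resolve_left
    (neg_ne_zero.2 (div_ne_zero Complex.I_ne_zero (Complex.ofReal_ne_zero.2 hħ)))

theorem mapsTo_of_forward_mapsTo (hU : IsPropagator ħ H U) (hħ : ħ ≠ 0)
    (hH : H.IsFormalAdjoint H) (hdense : Dense (H.domain : Set 𝓗)) {μ : ℝ}
    (hsurj : Function.Surjective (subScalar H (μ : ℂ))) {M : Submodule ℂ 𝓗}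
    [M.HasOrthogonalProjection] (hM : ∀ t, 0 ≤ t → Set.MapsTo (U t) M M) (t : ℝ) :
    Set.MapsTo (U t) M M := fun x hx => by
  have hcomm := hU.apply_comm_of_map_comm hH hdense
    (starProjection_mem_domain_and_map hH hsurj M
      fun _ hv => hU.mem_of_subScalar_mem hħ hH hdense hsurj hM hv) t x
  rw [Submodule.starProjection_eq_self_iff.2 hx] at hcomm
  exact Submodule.starProjection_eq_self_iff.1 hcomm.symm

end IsPropagator

/-- The subspace of initial states whose transition amplitude to `x` under the evolution `U` is zero
at all times `t ≥ 0`. -/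
noncomputable def neverReaching (U : ℝ → 𝓗 →L[ℂ] 𝓗) (x : 𝓗) : Submodule ℂ 𝓗 :=
  ⨅ t : Set.Ici (0 : ℝ), (innerSL ℂ x ∘L U t).ker

theorem mem_neverReaching {x y : 𝓗} :
    y ∈ neverReaching U x ↔ ∀ t, 0 ≤ t → ⟪x, U t y⟫_ℂ = 0 := by
  simp [neverReaching]

theorem isClosed_neverReaching (U : ℝ → 𝓗 →L[ℂ] 𝓗) (x : 𝓗) :
    IsClosed (neverReaching U x : Set 𝓗) := by
  rw [neverReaching, Submodule.coe_iInf]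
  exact isClosed_iInter fun t => (innerSL ℂ x ∘L U t).isClosed_ker

namespace IsPropagator

theorem mapsTo_neverReaching (hU : IsPropagator ħ H U) (hH : H.IsFormalAdjoint H)
    (hdense : Dense (H.domain : Set 𝓗)) (x : 𝓗) {t : ℝ} (ht : 0 ≤ t) :
    Set.MapsTo (U t) (neverReaching U x) (neverReaching U x) := fun y hy =>
  mem_neverReaching.2 fun s hs => by
    rw [← hU.apply_add hH hdense]
    exact mem_neverReaching.1 hy (s + t) (add_nonneg hs ht)

theorem inner_apply_eq_zero_of_eventually [CompleteSpace 𝓗] (hU : IsPropagator ħ H U)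
    (hħ : ħ ≠ 0) (hH : H.IsFormalAdjoint H) (hdense : Dense (H.domain : Set 𝓗)) {μ : ℝ}
    (hsurj : Function.Surjective (subScalar H (μ : ℂ))) {x y : 𝓗}
    (hxy : ∀ᶠ t in Filter.atTop, ⟪x, U t y⟫_ℂ = 0) (t : ℝ) : ⟪x, U t y⟫_ℂ = 0 := by
  obtain ⟨T, hT⟩ := Filter.eventually_atTop.1 hxy
  have hUTy : U T y ∈ neverReaching U x := mem_neverReaching.2 fun s hs => by
    rw [← hU.apply_add hH hdense]
    exact hT (s + T) (le_add_of_nonneg_left hs)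
  have : CompleteSpace (neverReaching U x) := (isClosed_neverReaching U x).completeSpace_coe
  have hUty := hU.mapsTo_of_forward_mapsTo hħ hH hdense hsurj
    (fun _ => hU.mapsTo_neverReaching hH hdense x) (t - T) hUTy
  rw [← hU.apply_add hH hdense, sub_add_cancel] at hUty
  simpa only [hU.apply_zero] using mem_neverReaching.1 hUty 0 le_rfl

end IsPropagator

theorem isPropagator_timeEvolution_of_apply_ne_zero {t : ℝ} {x : 𝓗}
    (h : timeEvolution ħ H t x ≠ 0) : IsPropagator ħ H (timeEvolution ħ H) := by
  unfold timeEvolution at h ⊢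
  split_ifs at h ⊢ with hex
  · exact hex.choose_spec
  · exact absurd rfl h

end Propagator

theorem theorem2_general {𝓗 : Type*} [NormedAddCommGroup 𝓗] [InnerProductSpace ℂ 𝓗]
    [CompleteSpace 𝓗] (ħ : ℝ) (hħ : ħ ≠ 0) (H : 𝓗 →ₗ.[ℂ] 𝓗) (hH : IsSelfAdjoint H) (s₁ s₂ : 𝓗)
    (t : ℝ) (hamp : ⟪s₂, timeEvolution ħ H t s₁⟫_ℂ ≠ 0)
    (hret : ∀ᶠ τ in Filter.atTop, ⟪s₁, timeEvolution ħ H τ s₂⟫_ℂ = 0) (μ : ℝ) :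
    (μ : ℂ) ∈ operatorSpectrum H := by
  have hsymm := isFormalAdjoint_self_of_isSelfAdjoint hH
  have hU : IsPropagator ħ H (timeEvolution ħ H) :=
    isPropagator_timeEvolution_of_apply_ne_zero fun h => hamp (by rw [h, inner_zero_right])
  intro hbij
  have hzero := hU.inner_apply_eq_zero_of_eventually hħ hsymm hH.dense_domain hbij.2 hret (-t)
  rw [← hU.inner_apply_left hsymm hH.dense_domain] at hzero
  exact hamp (inner_eq_zero_symm.1 hzero)

theorem theorem2 {𝓗 : Type*} [NormedAddCommGroup 𝓗] [InnerProductSpace ℂ 𝓗] [CompleteSpace 𝓗]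
    (ħ : ℝ) (hħ : 0 < ħ) (H : 𝓗 →ₗ.[ℂ] 𝓗) (hH : IsSelfAdjoint H)
    (s₁ s₂ : 𝓗) (hs₁ : ‖s₁‖ = 1) (hs₂ : ‖s₂‖ = 1) (t₁ t₂ : ℝ) (ht : t₁ < t₂)
    (hamp : ⟪s₂, timeEvolution ħ H (t₂ - t₁) s₁⟫_ℂ ≠ 0)
    (hdist : ⟪s₁, s₂⟫_ℂ = 0)
    (hret : ∀ t : ℝ, t₂ < t → ‖⟪s₁, timeEvolution ħ H (t - t₂) s₂⟫_ℂ‖ ^ 2 = 0) :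
    ¬ IsBoundedBelow H ∧ ¬ HasGroundState H := by
  have hret' : ∀ᶠ τ in Filter.atTop, ⟪s₁, timeEvolution ħ H τ s₂⟫_ℂ = 0 := by
    filter_upwards [Filter.eventually_gt_atTop 0] with τ hτ
    simpa using hret (τ + t₂) (lt_add_of_pos_left t₂ hτ)
  have hspec := theorem2_general ħ hħ.ne' H hH s₁ s₂ (t₂ - t₁) hamp hret'
  have hunbounded : ¬ IsBoundedBelow H := fun ⟨E, hE⟩ =>
    hE.notMem_operatorSpectrum hH (sub_one_lt E) (hspec (E - 1))
  exact ⟨hunbounded, fun h => hunbounded h.isBoundedBelow⟩
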